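/- For $\lambda\in(0,1/2]$ let $K_\lambda\subset\mathbb R$ be the self-similar set generated by the iterated function system $\{f_{\lambda,d}(y)=\lambda y+d(1-\lambda): d=0,1\}$, i.e. the unique nonempty compact set with $$K_\lambda=f_{\lambda,0}(K_\lambda)\cup f_{\lambda,1}(K_\lambda)=\Big\{(1-\lambda)\sum_{n=1}^\infty i_n\lambda^{n-1}: i_n\in\{0,1\}\ \forall n\ge 1\Big\}.$$ For $x\in(0,1/2)$ let $\Lambda(x)=\{\lambda\in(0,1/2]: x\in K_\lambda\}$, and let $\dim_H$ denote Hausdorff dimension. Then for every $x\in(0,1/2)$ the set $\Lambda(x)$ has Lebesgue measure zero and $\dim_H\Lambda(x)=1$. Furthermore, for every $\lambda\in\Lambda(x)$, $$\lim_{\delta\to0^+}\dim_H\big(\Lambda(x)\cap(\lambda-\delta,\lambda+\delta)\big)=\frac{\log 2}{-\log\lambda}=\dim_H K_\lambda .$$ -/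

import Mathlib

/-!
An address of `x` at ratio `l` is a digit sequence `i` with `coding l i = x`, and `Λ(x)` is the
projection to `l` of the pairs `(l, i)` so related. As `x < 1 / 2`, every address of `x` starts
with `0`, so on `(0, 1 / 2)` its coding increases with `l`, at a rate bounded away from zero on
compact subintervals. Two parameters whose addresses first differ at place `n` are therefore as far
apart as two points of `K_l` whose addresses first differ there: about `l ^ n`.

Covering by the `2 ^ n` cylinders of length `n` bounds the dimension from above. For the lower
bound, move an address of `x` so that its coding crosses `x` strictly; by continuity so do the
codings of a whole cylinder, the intermediate value theorem gives each of its members a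
parameter, and reading addresses in base two maps these parameters onto an interval, Hölder
continuously.
-/

open MeasureTheory Set Filter Topology

noncomputable section

namespace CantorParam

/-- The maps `f_{l,d}(y) = l y + d (1 - l)`, `d ∈ {0, 1}`, of the iterated function system. -/
def ifsMap (l : ℝ) (d : Fin 2) (y : ℝ) : ℝ := l * y + (d : ℕ) * (1 - l)

/-- `K` is a nonempty compact set with `K = f_{l,0}(K) ∪ f_{l,1}(K)`. -/
def IsAttractor (l : ℝ) (K : Set ℝ) : Prop :=
  K.Nonempty ∧ IsCompact K ∧ K = ifsMap l 0 '' K ∪ ifsMap l 1 '' K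

/-- The coding map `(i_n) ↦ (1 - l) ∑_{n ≥ 0} i_n l^n`. -/
def coding (l : ℝ) (i : ℕ → Fin 2) : ℝ := (1 - l) * ∑' n : ℕ, ((i n : ℕ) : ℝ) * l ^ n

/-- The self-similar set `K_l = {(1 - l) ∑_{n ≥ 0} i_n l^n : i_n ∈ {0, 1}}`. By
`isAttractor_iff` below, for `0 < l < 1` it is the unique nonempty compact set with
`K = f_{l,0}(K) ∪ f_{l,1}(K)`. -/
def selfSimilarSet (l : ℝ) : Set ℝ := Set.range (coding l)

/-- `Λ(x) = {l ∈ (0, 1/2] : x ∈ K_l}`. -/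
def paramSet (x : ℝ) : Set ℝ := {l : ℝ | l ∈ Set.Ioc (0 : ℝ) (1 / 2) ∧ x ∈ selfSimilarSet l}

theorem digit_le_one (d : Fin 2) : ((d : ℕ) : ℝ) ≤ 1 := by
  exact_mod_cast Nat.lt_succ_iff.mp d.isLt

theorem summable_digits {l : ℝ} (h0 : 0 < l) (h1 : l < 1) (i : ℕ → Fin 2) :
    Summable fun n : ℕ => ((i n : ℕ) : ℝ) * l ^ n := by
  refine Summable.of_nonneg_of_le (fun n => by positivity) (fun n => ?_)
    (summable_geometric_of_lt_one h0.le h1)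
  exact mul_le_of_le_one_left (by positivity) (digit_le_one _)

theorem continuous_coding {l : ℝ} (h0 : 0 < l) (h1 : l < 1) : Continuous (coding l) := by
  refine continuous_const.mul (continuous_tsum (u := fun n => l ^ n) (fun n => ?_)
    (summable_geometric_of_lt_one h0.le h1) fun n i => ?_)
  · exact ((continuous_of_discreteTopology (f := fun d : Fin 2 => ((d : ℕ) : ℝ))).comp
      (continuous_apply n)).mul continuous_const
  · rw [Real.norm_of_nonneg (by positivity)]
    exact mul_le_of_le_one_left (by positivity) (digit_le_one _)

theorem coding_eq {l : ℝ} (h0 : 0 < l) (h1 : l < 1) (i : ℕ → Fin 2) :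
    coding l i = ifsMap l (i 0) (coding l fun n => i (n + 1)) := by
  unfold coding ifsMap
  rw [(summable_digits h0 h1 i).tsum_eq_zero_add]
  have : ∑' n : ℕ, ((i (n + 1) : ℕ) : ℝ) * l ^ (n + 1)
      = l * ∑' n : ℕ, ((i (n + 1) : ℕ) : ℝ) * l ^ n := by
    rw [← tsum_mul_left]
    exact tsum_congr fun n => by ring
  rw [this]
  ring

theorem mem_ifs_iff {l : ℝ} {K : Set ℝ} {y : ℝ} :
    y ∈ ifsMap l 0 '' K ∪ ifsMap l 1 '' K ↔ ∃ d : Fin 2, ∃ z ∈ K, ifsMap l d z = y := by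
  rw [Fin.exists_fin_two]
  rfl

theorem isAttractor_selfSimilarSet {l : ℝ} (h0 : 0 < l) (h1 : l < 1) :
    IsAttractor l (selfSimilarSet l) := by
  refine ⟨range_nonempty _, isCompact_range (continuous_coding h0 h1), ?_⟩
  ext y
  rw [mem_ifs_iff]
  constructor
  · rintro ⟨i, rfl⟩
    exact ⟨i 0, _, ⟨fun n => i (n + 1), rfl⟩, (coding_eq h0 h1 i).symm⟩
  · rintro ⟨d, _, ⟨i, rfl⟩, rfl⟩
    exact ⟨fun n => Nat.casesOn n d i, coding_eq h0 h1 _⟩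

theorem dist_coding_le {l : ℝ} (h0 : 0 < l) (h1 : l < 1) {C : ℝ} (i : ℕ → Fin 2) (z : ℕ → ℝ)
    (hz : ∀ n, z n = ifsMap l (i n) (z (n + 1))) (N : ℕ)
    (hC : |z N - coding l fun n => i (n + N)| ≤ C) :
    |z 0 - coding l i| ≤ l ^ N * C := by
  induction N generalizing i z with
  | zero => simpa using hC
  | succ N ih =>
    have h := ih (fun n => i (n + 1)) (fun n => z (n + 1)) (fun n => hz (n + 1)) hC
    rw [hz 0, coding_eq h0 h1 i]
    have e : ifsMap l (i 0) (z (0 + 1)) - ifsMap l (i 0) (coding l fun n => i (n + 1))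
        = l * (z (0 + 1) - coding l fun n => i (n + 1)) := by
      unfold ifsMap; ring
    rw [e, abs_mul, abs_of_pos h0, pow_succ']
    calc l * _ ≤ l * (l ^ N * C) := mul_le_mul_of_nonneg_left h h0.le
      _ = l * l ^ N * C := by ring

/-- `selfSimilarSet l` is the unique nonempty compact set invariant under the system. -/
theorem isAttractor_iff {l : ℝ} (h0 : 0 < l) (h1 : l < 1) (K : Set ℝ) :
    IsAttractor l K ↔ K = selfSimilarSet l := by
  refine ⟨fun hK => ?_, fun h => h ▸ isAttractor_selfSimilarSet h0 h1⟩
  obtain ⟨hne, hc, hK⟩ := hK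
  obtain ⟨-, hc', -⟩ := isAttractor_selfSimilarSet h0 h1
  obtain ⟨A, hA⟩ := hc.isBounded.exists_norm_le
  obtain ⟨B, hB⟩ := hc'.isBounded.exists_norm_le
  have hAB : ∀ y ∈ K, ∀ i, |y - coding l i| ≤ A + B := fun y hy i =>
    (norm_sub_le _ _).trans (add_le_add (hA y hy) (hB _ ⟨i, rfl⟩))
  have hlim : Tendsto (fun N : ℕ => l ^ N * (A + B)) atTop (𝓝 0) := by
    simpa using (tendsto_pow_atTop_nhds_zero_of_lt_one h0.le h1).mul_const (A + B)
  apply Subset.antisymm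
  · intro y hy
    have step : ∀ w : K, ∃ p : Fin 2 × K, ifsMap l p.1 p.2 = w := by
      rintro ⟨w, hw⟩
      rw [hK, mem_ifs_iff] at hw
      obtain ⟨d, z, hz, h⟩ := hw
      exact ⟨(d, ⟨z, hz⟩), h⟩
    choose p hp using step
    let z : ℕ → K := fun n => (fun w => (p w).2)^[n] ⟨y, hy⟩
    have hz : ∀ n, (z n : ℝ) = ifsMap l (p (z n)).1 (z (n + 1)) := fun n => by
      have : z (n + 1) = (p (z n)).2 := Function.iterate_succ_apply' _ _ _
      rw [this, hp]
    refine ⟨fun n => (p (z n)).1, ?_⟩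
    have hle : |y - coding l fun n => (p (z n)).1| ≤ 0 :=
      ge_of_tendsto' hlim fun N =>
        dist_coding_le h0 h1 _ (fun n => (z n : ℝ)) hz N (hAB _ (z N).2 _)
    exact (sub_eq_zero.mp (abs_nonpos_iff.mp hle)).symm
  · rintro _ ⟨i, rfl⟩
    obtain ⟨y, hy⟩ := hne
    have key : ∀ (N : ℕ) (i : ℕ → Fin 2), ∃ w ∈ K, |w - coding l i| ≤ l ^ N * (A + B) := by
      intro N
      induction N with
      | zero => exact fun i => ⟨y, hy, by simpa using hAB y hy i⟩
      | succ N ih =>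
        intro i
        obtain ⟨w, hw, h⟩ := ih fun n => i (n + 1)
        refine ⟨ifsMap l (i 0) w, by rw [hK, mem_ifs_iff]; exact ⟨_, w, hw, rfl⟩, ?_⟩
        have e : ifsMap l (i 0) w - ifsMap l (i 0) (coding l fun n => i (n + 1))
            = l * (w - coding l fun n => i (n + 1)) := by
          unfold ifsMap; ring
        rw [coding_eq h0 h1 i, e, abs_mul, abs_of_pos h0, pow_succ']
        calc l * _ ≤ l * (l ^ N * (A + B)) := mul_le_mul_of_nonneg_left h h0.le
          _ = l * l ^ N * (A + B) := by ring
    choose w hw hwl using fun N => key N i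
    refine hc.isClosed.mem_of_tendsto (f := w) (b := atTop) ?_ (Eventually.of_forall hw)
    exact tendsto_iff_dist_tendsto_zero.mpr
      (squeeze_zero (fun _ => dist_nonneg) hwl hlim)

end CantorParam

end

namespace CantorParam

open scoped NNReal ENNReal
open PiNat (cylinder firstDiff)
open Real (ofDigits)

/-! ### Hausdorff dimension of sets coded by digit sequences -/

section Dimension

variable {ι X : Type*} {S : Set ι}

theorem mul_dimH_image_le_dimH_image {Y : Type*} [EMetricSpace X] [EMetricSpace Y] {f : ι → X}
    {g : ι → Y} {C s : ℝ≥0}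
    (h : ∀ p ∈ S, ∀ q ∈ S, edist (g p) (g q) ≤ C * edist (f p) (f q) ^ (s : ℝ)) :
    s * dimH (g '' S) ≤ dimH (f '' S) := by
  obtain rfl | ⟨p₀, -⟩ := S.eq_empty_or_nonempty
  · simp
  obtain rfl | hs := eq_zero_or_pos s
  · simp
  have : Nonempty ι := ⟨p₀⟩
  -- By `h`, on `S` the map `g` factors through `f` as a Hölder map.
  let e : X → ι := Function.invFunOn f S
  have he : ∀ y ∈ f '' S, e y ∈ S ∧ f (e y) = y := fun y hy =>
    ⟨Function.invFunOn_mem hy, Function.invFunOn_eq hy⟩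
  have hholder : HolderOnWith C s (g ∘ e) (f '' S) := fun y hy z hz => by
    simpa only [Function.comp_apply, (he y hy).2, (he z hz).2] using h _ (he y hy).1 _ (he z hz).1
  have hge : ∀ p ∈ S, g (e (f p)) = g p := fun p hp => by
    obtain ⟨heS, hfe⟩ := he _ (mem_image_of_mem f hp)
    have hle := h _ heS p hp
    rw [hfe, edist_self, ENNReal.zero_rpow_of_pos (by exact_mod_cast hs), mul_zero] at hle
    exact edist_le_zero.1 hle
  have himage : (g ∘ e) '' (f '' S) = g '' S := by
    rw [image_image]
    exact image_congr hge
  rw [mul_comm, ← ENNReal.le_div_iff_mul_le (by simp [hs.ne']) (by simp), ← himage]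
  exact hholder.dimH_image_le hs

theorem dimH_le_of_card_mul_rpow_le [EMetricSpace X] {A : Set X} {β : ℕ → Type*}
    [∀ n, Fintype (β n)] {t : ∀ n, β n → Set X} {d : ℕ → ℝ} {M : ℝ} {s : ℝ≥0} (hd0 : ∀ n, 0 ≤ d n)
    (hd : Tendsto d atTop (𝓝 0)) (hcover : ∀ n, A ⊆ ⋃ w, t n w)
    (hdiam : ∀ n w, Metric.ediam (t n w) ≤ ENNReal.ofReal (d n))
    (hM : ∀ n, Fintype.card (β n) * d n ^ (s : ℝ) ≤ M) : dimH A ≤ s := by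
  borelize X
  have hlim : Tendsto (fun n => ENNReal.ofReal (d n)) atTop (𝓝 0) := by
    simpa only [ENNReal.ofReal_zero] using ENNReal.tendsto_ofReal hd
  have hsum (n : ℕ) : ∑ w, Metric.ediam (t n w) ^ (s : ℝ) ≤ ENNReal.ofReal M := by
    calc ∑ w, Metric.ediam (t n w) ^ (s : ℝ)
        ≤ ∑ _w : β n, ENNReal.ofReal (d n ^ (s : ℝ)) := by
          gcongr with w
          rw [← ENNReal.ofReal_rpow_of_nonneg (hd0 n) s.coe_nonneg]
          gcongr
          exact hdiam n w
      _ = ENNReal.ofReal (Fintype.card (β n) * d n ^ (s : ℝ)) := by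
          rw [Finset.sum_const, ← ENNReal.ofReal_nsmul, Finset.card_univ, nsmul_eq_mul]
      _ ≤ ENNReal.ofReal M := ENNReal.ofReal_le_ofReal (hM n)
  suffices hle : μH[s] A ≤ ENNReal.ofReal M from
    dimH_le_of_hausdorffMeasure_ne_top (ne_top_of_le_ne_top ENNReal.ofReal_ne_top hle)
  calc μH[s] A ≤ liminf (fun n => ∑ w, Metric.ediam (t n w) ^ (s : ℝ)) atTop :=
        Measure.hausdorffMeasure_le_liminf_sum _ _ _ hlim t (.of_forall hdiam) (.of_forall hcover)
    _ ≤ liminf (fun _ : ℕ => ENNReal.ofReal M) atTop := liminf_le_liminf (.of_forall hsum)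
    _ = ENNReal.ofReal M := liminf_const _

variable [MetricSpace X] {f : ι → X} {r : ℝ} {s : ℝ≥0}

theorem dimH_image_le_of_dist_le_pow {α : Type*} [Fintype α] {σ : ι → ℕ → α} {C : ℝ} (hC : 0 ≤ C)
    (hr0 : 0 ≤ r) (hr1 : r < 1) (hs : Fintype.card α * r ^ (s : ℝ) ≤ 1)
    (h : ∀ p ∈ S, ∀ q ∈ S, ∀ n, σ p ∈ cylinder (σ q) n → dist (f p) (f q) ≤ C * r ^ n) :
    dimH (f '' S) ≤ s := by
  have hlim : Tendsto (fun n => C * r ^ n) atTop (𝓝 0) := by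
    simpa only [mul_zero] using (tendsto_pow_atTop_nhds_zero_of_lt_one hr0 hr1).const_mul C
  refine dimH_le_of_card_mul_rpow_le (β := fun n => Fin n → α) (M := C ^ (s : ℝ))
    (t := fun n w => f '' {p ∈ S | ∀ k : Fin n, σ p k = w k}) (fun n => by positivity) hlim
    (fun n => ?_) (fun n w => Metric.ediam_le ?_) fun n => ?_
  · rintro _ ⟨p, hp, rfl⟩
    exact mem_iUnion.2 ⟨fun k => σ p k, p, ⟨hp, fun _ => rfl⟩, rfl⟩
  · rintro _ ⟨p, ⟨hp, hpw⟩, rfl⟩ _ ⟨q, ⟨hq, hqw⟩, rfl⟩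
    rw [edist_dist]
    exact ENNReal.ofReal_le_ofReal <| h p hp q hq n fun k hk =>
      (hpw ⟨k, hk⟩).trans (hqw ⟨k, hk⟩).symm
  · calc (Fintype.card (Fin n → α) : ℝ) * (C * r ^ n) ^ (s : ℝ)
        = C ^ (s : ℝ) * (Fintype.card α * r ^ (s : ℝ)) ^ n := by
          rw [Fintype.card_fun, Fintype.card_fin, Real.mul_rpow hC (by positivity),
            ← Real.rpow_pow_comm hr0, Nat.cast_pow, mul_pow, mul_left_comm]
      _ ≤ C ^ (s : ℝ) :=
          mul_le_of_le_one_right (by positivity) (pow_le_one₀ (by positivity) hs)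

theorem mul_dimH_ofDigits_image_le {N : ℕ} {σ : ι → ℕ → Fin N} {c : ℝ} (hc : 0 < c) (hr : 0 ≤ r)
    (hs : 1 ≤ N * r ^ (s : ℝ))
    (h : ∀ p ∈ S, ∀ q ∈ S, σ p ≠ σ q → c * r ^ firstDiff (σ p) (σ q) ≤ dist (f p) (f q)) :
    s * dimH (ofDigits '' (σ '' S)) ≤ dimH (f '' S) := by
  rw [image_image]
  refine mul_dimH_image_le_dimH_image (C := ((c⁻¹) ^ (s : ℝ)).toNNReal) fun p hp q hq => ?_
  obtain heq | hne := eq_or_ne (σ p) (σ q)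
  · simp [heq]
  have hN : (0 : ℝ) < N := by exact_mod_cast Fin.pos (σ p 0)
  set n := firstDiff (σ p) (σ q)
  have hreal : dist (ofDigits (σ p)) (ofDigits (σ q)) ≤
      (c⁻¹) ^ (s : ℝ) * dist (f p) (f q) ^ (s : ℝ) := by
    calc dist (ofDigits (σ p)) (ofDigits (σ q)) ≤ ((N : ℝ) ^ n)⁻¹ :=
          Real.abs_ofDigits_sub_ofDigits_le fun _ => PiNat.apply_eq_of_lt_firstDiff
      _ = (N : ℝ)⁻¹ ^ n := (inv_pow _ _).symm
      _ ≤ (r ^ (s : ℝ)) ^ n := by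
          gcongr
          exact (inv_le_iff_one_le_mul₀' hN).2 hs
      _ = (r ^ n) ^ (s : ℝ) := Real.rpow_pow_comm hr _ _
      _ ≤ (c⁻¹ * dist (f p) (f q)) ^ (s : ℝ) := by
          gcongr
          exact (le_inv_mul_iff₀ hc).2 (h p hp q hq hne)
      _ = (c⁻¹) ^ (s : ℝ) * dist (f p) (f q) ^ (s : ℝ) :=
          Real.mul_rpow (by positivity) dist_nonneg
  rw [edist_dist, edist_dist, ENNReal.ofReal_rpow_of_nonneg dist_nonneg s.coe_nonneg]
  calc _ ≤ ENNReal.ofReal ((c⁻¹) ^ (s : ℝ) * dist (f p) (f q) ^ (s : ℝ)) :=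
        ENNReal.ofReal_le_ofReal hreal
    _ = _ := ENNReal.ofReal_mul (by positivity)

theorem dimH_le_one (A : Set ℝ) : dimH A ≤ 1 :=
  (dimH_mono (subset_univ A)).trans_eq Real.dimH_univ

theorem range_ofDigits {N : ℕ} (hN : 1 < N) : range (ofDigits (b := N)) = Icc 0 1 := by
  refine Subset.antisymm ?_ fun y hy => ?_
  · rintro _ ⟨i, rfl⟩
    exact ⟨Real.ofDigits_nonneg i, Real.ofDigits_le_one i⟩
  · obtain ⟨i, -, hi⟩ := Real.ofDigits_SurjOn hN hy
    exact ⟨i, hi⟩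

theorem Icc_subset_ofDigits_image_cylinder {N : ℕ} (hN : 1 < N) (i : ℕ → Fin N) (n : ℕ) :
    Icc (∑ k ∈ Finset.range n, Real.ofDigitsTerm i k)
      (∑ k ∈ Finset.range n, Real.ofDigitsTerm i k + ((N : ℝ) ^ n)⁻¹) ⊆
      ofDigits '' cylinder i n := by
  set u := ∑ k ∈ Finset.range n, Real.ofDigitsTerm i k
  have hNn : (0 : ℝ) < (N : ℝ) ^ n := by positivity
  rintro y ⟨huy, hyu⟩
  obtain ⟨j, hj⟩ : (N : ℝ) ^ n * (y - u) ∈ range (ofDigits (b := N)) := by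
    rw [range_ofDigits hN]
    refine ⟨mul_nonneg hNn.le (sub_nonneg.2 huy), ?_⟩
    rw [← le_inv_mul_iff₀ hNn, mul_one]
    linarith
  let w (k : ℕ) : Fin N := if k < n then i k else j (k - n)
  have hw : ∀ k < n, w k = i k := fun k hk => if_pos hk
  have hsum : ∑ k ∈ Finset.range n, Real.ofDigitsTerm w k = u :=
    Finset.sum_congr rfl fun k hk => by
      simp only [Real.ofDigitsTerm, hw k (Finset.mem_range.1 hk)]
  have htail : (fun k => w (k + n)) = j := by
    funext k
    simp [w]
  refine ⟨w, hw, ?_⟩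
  rw [Real.ofDigits_eq_sum_add_ofDigits w n, hsum, htail, hj, inv_mul_cancel_left₀ hNn.ne']
  ring

theorem dimH_ofDigits_image_cylinder {N : ℕ} (hN : 1 < N) (i : ℕ → Fin N) (n : ℕ) :
    dimH (ofDigits '' cylinder i n) = 1 := by
  have hNn : (0 : ℝ) < ((N : ℝ) ^ n)⁻¹ := by positivity
  rw [Real.dimH_of_nonempty_interior, Module.finrank_self, Nat.cast_one]
  refine (nonempty_Ioo.2 ?_).mono
    ((interior_Icc (α := ℝ)).symm.subset.trans
      (interior_mono (Icc_subset_ofDigits_image_cylinder hN i n)))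
  linarith

end Dimension


/-- The dimension `log 2 / (-log l)` of the self-similar set of ratio `l`, which is the solution
`s` of `2 * l ^ s = 1`; meaningful for `0 < l < 1` only. -/
noncomputable def similarityDim (l : ℝ) : ℝ≥0 := (Real.log 2 / (-Real.log l)).toNNReal

theorem two_mul_rpow_similarityDim {l : ℝ} (h0 : 0 < l) (h1 : l < 1) :
    2 * l ^ (similarityDim l : ℝ) = 1 := by
  have hlog : Real.log l < 0 := Real.log_neg h0 h1
  have hpos : 0 ≤ Real.log 2 / (-Real.log l) :=
    div_nonneg (Real.log_nonneg one_le_two) (neg_nonneg.2 hlog.le)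
  have hexp : Real.log l * (Real.log 2 / (-Real.log l)) = -Real.log 2 := by
    field_simp [hlog.ne]
  rw [similarityDim, Real.coe_toNNReal _ hpos, Real.rpow_def_of_pos h0, hexp, Real.exp_neg,
    Real.exp_log two_pos, mul_inv_cancel₀ two_ne_zero]

theorem similarityDim_half : similarityDim (1 / 2) = 1 := by
  have hlog : Real.log 2 ≠ 0 := (Real.log_pos one_lt_two).ne'
  simp [similarityDim, hlog]

theorem strictMonoOn_similarityDim : StrictMonoOn similarityDim (Ioo 0 1) := by
  intro l hl m hm hlm
  have hm' : 0 < -Real.log m := neg_pos.2 (Real.log_neg hm.1 hm.2)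
  have h2 : 0 < Real.log 2 := Real.log_pos one_lt_two
  refine (Real.toNNReal_lt_toNNReal_iff (div_pos h2 hm')).2 ?_
  have := Real.log_lt_log hl.1 hlm
  gcongr

theorem continuousAt_similarityDim {l : ℝ} (h0 : 0 < l) (h1 : l < 1) :
    ContinuousAt similarityDim l :=
  continuous_real_toNNReal.continuousAt.comp <| continuousAt_const.div
    (Real.continuousAt_log h0.ne').neg (neg_ne_zero.2 (Real.log_neg h0 h1).ne)

/-! ### The coding map -/

section Coding

variable {l m x : ℝ} {i j : ℕ → Fin 2} {n : ℕ}

theorem coding_mem_Icc (h0 : 0 < l) (h1 : l < 1) (i : ℕ → Fin 2) : coding l i ∈ Icc 0 1 := by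
  have hl : 0 < 1 - l := sub_pos.2 h1
  have hsum : ∑' n, ((i n : ℕ) : ℝ) * l ^ n ≤ (1 - l)⁻¹ := by
    rw [← tsum_geometric_of_lt_one h0.le h1]
    exact (summable_digits h0 h1 i).tsum_le_tsum
      (fun n => mul_le_of_le_one_left (by positivity) (digit_le_one _))
      (summable_geometric_of_lt_one h0.le h1)
  exact ⟨mul_nonneg hl.le (tsum_nonneg fun n => by positivity),
    (le_inv_mul_iff₀ hl).1 (by rwa [mul_one])⟩

theorem abs_coding_sub_coding_le_one (h0 : 0 < l) (h1 : l < 1) (hm0 : 0 < m) (hm1 : m < 1)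
    (i j : ℕ → Fin 2) : |coding l i - coding m j| ≤ 1 :=
  Real.dist_le_of_mem_Icc_01 (coding_mem_Icc h0 h1 i) (coding_mem_Icc hm0 hm1 j)

theorem coding_sub_coding_of_mem_cylinder (h0 : 0 < l) (h1 : l < 1) (h : i ∈ cylinder j n) :
    coding l i - coding l j =
      l ^ n * (coding l (fun k => i (k + n)) - coding l (fun k => j (k + n))) := by
  induction n generalizing i j with
  | zero => simp
  | succ n ih =>
    have hhead : i 0 = j 0 := h 0 n.succ_pos
    have htail : (fun k => i (k + 1)) ∈ cylinder (fun k => j (k + 1)) n :=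
      fun k hk => h (k + 1) (by omega)
    calc coding l i - coding l j
        = l * (coding l (fun k => i (k + 1)) - coding l (fun k => j (k + 1))) := by
          rw [coding_eq h0 h1 i, coding_eq h0 h1 j, hhead, ifsMap, ifsMap]
          ring
      _ = _ := by
          rw [ih htail, pow_succ', mul_assoc]
          simp only [add_assoc]

theorem abs_coding_sub_coding_le_pow (h0 : 0 < l) (h1 : l < 1) (h : i ∈ cylinder j n) :
    |coding l i - coding l j| ≤ l ^ n := by
  rw [coding_sub_coding_of_mem_cylinder h0 h1 h, abs_mul, abs_of_pos (pow_pos h0 n)]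
  exact mul_le_of_le_one_right (by positivity) (abs_coding_sub_coding_le_one h0 h1 h0 h1 _ _)

theorem le_abs_coding_sub_coding_of_head_ne (h0 : 0 < l) (h1 : l < 1) (h : i 0 ≠ j 0) :
    1 - 2 * l ≤ |coding l i - coding l j| := by
  wlog hij : i 0 = 0 generalizing i j
  · rw [abs_sub_comm]
    exact this h.symm (by omega)
  have hj : j 0 = 1 := by omega
  have hi1 := (coding_mem_Icc h0 h1 fun k => i (k + 1)).2
  have hj0 := (coding_mem_Icc h0 h1 fun k => j (k + 1)).1
  rw [coding_eq h0 h1 i, coding_eq h0 h1 j, hij, hj, le_abs]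
  right
  simp only [ifsMap, Fin.val_zero, Fin.val_one, Nat.cast_zero, Nat.cast_one]
  nlinarith

theorem mul_pow_firstDiff_le_abs_coding_sub_coding (h0 : 0 < l) (h1 : l < 1) (h : i ≠ j) :
    (1 - 2 * l) * l ^ firstDiff i j ≤ |coding l i - coding l j| := by
  rw [coding_sub_coding_of_mem_cylinder h0 h1 (PiNat.mem_cylinder_firstDiff i j), abs_mul,
    abs_of_pos (pow_pos h0 _), mul_comm]
  refine mul_le_mul_of_nonneg_left (le_abs_coding_sub_coding_of_head_ne h0 h1 ?_) (by positivity)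
  simpa only [zero_add] using PiNat.apply_firstDiff_ne h

theorem head_eq_zero_of_coding_lt (h0 : 0 < l) (h1 : l < 1) (h : coding l i < 1 - l) :
    i 0 = 0 := by
  by_contra hne
  have hi : i 0 = 1 := by omega
  have hnonneg := mul_nonneg h0.le (coding_mem_Icc h0 h1 fun k => i (k + 1)).1
  rw [coding_eq h0 h1 i, hi] at h
  simp only [ifsMap, Fin.val_one, Nat.cast_one] at h
  linarith

theorem coding_half : coding (1 / 2) = ofDigits := by
  funext i
  rw [coding, Real.ofDigits, ← tsum_mul_left]
  refine tsum_congr fun n => ?_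
  rw [Real.ofDigitsTerm, pow_succ, Nat.cast_ofNat, one_div, inv_pow]
  ring

theorem selfSimilarSet_half : selfSimilarSet (1 / 2) = Icc 0 1 := by
  rw [selfSimilarSet, coding_half, range_ofDigits one_lt_two]

/-! ### Dependence of the coding on the ratio -/

theorem mul_abs_coding_sub_coding_le (hl0 : 0 < l) (hl1 : l < 1) (hm0 : 0 < m) (hm1 : m < 1)
    (i : ℕ → Fin 2) : (1 - m) * |coding m i - coding l i| ≤ |m - l| := by
  set D : ℝ := ⨆ i, |coding m i - coding l i|
  have hle (i : ℕ → Fin 2) : |coding m i - coding l i| ≤ D :=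
    le_ciSup (f := fun i => |coding m i - coding l i|)
      ⟨1, forall_mem_range.2 fun i => abs_coding_sub_coding_le_one hm0 hm1 hl0 hl1 i i⟩ i
  have hstep (i : ℕ → Fin 2) : |coding m i - coding l i| ≤ m * D + |m - l| := by
    set t : ℕ → Fin 2 := fun k => i (k + 1)
    have hdigit : |coding l t - (i 0 : ℕ)| ≤ 1 :=
      Real.dist_le_of_mem_Icc_01 (coding_mem_Icc hl0 hl1 t) ⟨Nat.cast_nonneg _, digit_le_one _⟩
    calc |coding m i - coding l i|
        = |m * (coding m t - coding l t) + (m - l) * (coding l t - (i 0 : ℕ))| := by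
          rw [coding_eq hl0 hl1 i, coding_eq hm0 hm1 i, ifsMap, ifsMap]
          congr 1
          ring
      _ ≤ m * |coding m t - coding l t| + |m - l| * |coding l t - (i 0 : ℕ)| := by
          refine (abs_add_le _ _).trans_eq ?_
          rw [abs_mul, abs_mul, abs_of_pos hm0]
      _ ≤ m * D + |m - l| * 1 := by
          gcongr
          exact hle t
      _ = m * D + |m - l| := by rw [mul_one]
  have hD : D ≤ m * D + |m - l| := ciSup_le hstep
  have := mul_le_mul_of_nonneg_left (hle i) (sub_pos.2 hm1).le
  linarith

theorem continuousAt_coding_left (h0 : 0 < l) (h1 : l < 1) (i : ℕ → Fin 2) :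
    ContinuousAt (coding · i) l := by
  have hlim : Tendsto (fun m => (1 - m)⁻¹ * |m - l|) (𝓝 l) (𝓝 0) := by
    have : ContinuousAt (fun m => (1 - m)⁻¹ * |m - l|) l := by
      fun_prop (disch := exact (sub_pos.2 h1).ne')
    simpa [ContinuousAt] using this
  refine tendsto_iff_dist_tendsto_zero.2 (squeeze_zero' (.of_forall fun _ => dist_nonneg) ?_ hlim)
  filter_upwards [Ioo_mem_nhds h0 h1] with m hm
  exact (le_inv_mul_iff₀ (sub_pos.2 hm.2)).2 (mul_abs_coding_sub_coding_le h0 h1 hm.1 hm.2 i)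

theorem mul_coding_le_mul_coding (h0 : 0 < l) (hlm : l ≤ m) (h1 : m < 1) (i : ℕ → Fin 2) :
    (1 - m) * coding l i ≤ (1 - l) * coding m i := by
  have hm0 : 0 < m := h0.trans_le hlm
  have hl1 : l < 1 := hlm.trans_lt h1
  have hsum : ∑' n, ((i n : ℕ) : ℝ) * l ^ n ≤ ∑' n, ((i n : ℕ) : ℝ) * m ^ n :=
    (summable_digits h0 hl1 i).tsum_le_tsum (fun n => by gcongr) (summable_digits hm0 h1 i)
  have := mul_le_mul_of_nonneg_left hsum
    (mul_nonneg (sub_nonneg.2 h1.le) (sub_nonneg.2 hl1.le))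
  unfold coding
  linarith

theorem coding_mul_le_coding_sub_coding (h0 : 0 < l) (hlm : l ≤ m) (hsum : l + m ≤ 1)
    (hi : i 0 = 0) : coding l i * ((m - l) * (1 - l - m)) ≤ coding m i - coding l i := by
  have hm0 : 0 < m := h0.trans_le hlm
  have hl1 : l < 1 := by linarith
  have hm1 : m < 1 := by linarith
  have htail {r : ℝ} (hr0 : 0 < r) (hr1 : r < 1) :
      coding r i = r * coding r (fun k => i (k + 1)) := by
    simp [coding_eq hr0 hr1 i, ifsMap, hi]
  have hscaled : (1 - m) * m * coding l i ≤ (1 - l) * l * coding m i := by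
    have := mul_le_mul_of_nonneg_left
      (mul_coding_le_mul_coding h0 hlm hm1 fun k => i (k + 1)) (mul_pos h0 hm0).le
    rw [htail h0 hl1, htail hm0 hm1]
    linarith
  have hgain : 0 ≤ coding l i * ((m - l) * (1 - l - m)) :=
    mul_nonneg (coding_mem_Icc h0 hl1 i).1 (mul_nonneg (by linarith) (by linarith))
  have hle : coding l i * ((m - l) * (1 - l - m)) ≤ (1 - l) * l * (coding m i - coding l i) := by
    linarith
  have hpos : 0 < (1 - l) * l := mul_pos (by linarith) h0
  exact hle.trans <| mul_le_of_le_one_left (nonneg_of_mul_nonneg_right (hgain.trans hle) hpos)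
    (mul_le_one₀ (by linarith) h0.le hl1.le)

theorem coding_lt_coding (h0 : 0 < l) (hlm : l < m) (hsum : l + m < 1) (hi : i 0 = 0)
    (hpos : 0 < coding m i) : coding l i < coding m i := by
  obtain hzero | hl := (coding_mem_Icc h0 (by linarith : l < 1) i).1.eq_or_lt
  · rwa [← hzero]
  · have hgain : 0 < coding l i * ((m - l) * (1 - l - m)) :=
      mul_pos hl (mul_pos (by linarith) (by linarith))
    linarith [coding_mul_le_coding_sub_coding h0 hlm.le hsum.le hi]

end Coding

/-! ### The self-similar set -/

section SelfSimilarSet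

variable {l : ℝ}

theorem dimH_selfSimilarSet_half : dimH (selfSimilarSet (1 / 2)) = 1 := by
  rw [selfSimilarSet, coding_half, ← image_univ, ← PiNat.cylinder_zero 0,
    dimH_ofDigits_image_cylinder one_lt_two]

theorem dimH_selfSimilarSet_le (h0 : 0 < l) (h1 : l < 1) :
    dimH (selfSimilarSet l) ≤ similarityDim l := by
  rw [selfSimilarSet, ← image_univ]
  refine dimH_image_le_of_dist_le_pow (σ := id) zero_le_one h0.le h1
    (two_mul_rpow_similarityDim h0 h1).le fun i _ j _ n hij => ?_
  rw [one_mul]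
  exact abs_coding_sub_coding_le_pow h0 h1 hij

theorem similarityDim_le_dimH_selfSimilarSet (h0 : 0 < l) (hl : l < 1 / 2) :
    similarityDim l ≤ dimH (selfSimilarSet l) := by
  have h1 : l < 1 := by linarith
  calc (similarityDim l : ℝ≥0∞)
      = similarityDim l * dimH (ofDigits '' (id '' (univ : Set (ℕ → Fin 2)))) := by
        rw [image_id, image_univ, ← coding_half, ← selfSimilarSet, dimH_selfSimilarSet_half,
          mul_one]
    _ ≤ dimH (coding l '' univ) :=
        mul_dimH_ofDigits_image_le (by linarith : 0 < 1 - 2 * l) h0.le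
          (two_mul_rpow_similarityDim h0 h1).ge fun i _ j _ hij =>
            mul_pow_firstDiff_le_abs_coding_sub_coding h0 h1 hij
    _ = dimH (selfSimilarSet l) := by rw [image_univ, selfSimilarSet]

theorem dimH_selfSimilarSet (h0 : 0 < l) (hl : l ≤ 1 / 2) :
    dimH (selfSimilarSet l) = similarityDim l := by
  obtain rfl | hlt := hl.eq_or_lt
  · rw [dimH_selfSimilarSet_half, similarityDim_half, ENNReal.coe_one]
  · exact (dimH_selfSimilarSet_le h0 (by linarith)).antisymm
      (similarityDim_le_dimH_selfSimilarSet h0 hlt)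

end SelfSimilarSet

/-! ### The parameter set -/

/-- The pairs `(l, i)` of a ratio `l ∈ I` and an address `i` of `x` at ratio `l`. Its first
projection is the part of `paramSet x` in `I`; a parameter is counted once for each address. -/
def addressGraph (x : ℝ) (I : Set ℝ) : Set (ℝ × (ℕ → Fin 2)) :=
  {p | p.1 ∈ I ∧ coding p.1 p.2 = x}

section ParamSet

variable {x a b : ℝ} {i : ℕ → Fin 2} {n : ℕ} {p q : ℝ × (ℕ → Fin 2)}

theorem image_fst_addressGraph {I : Set ℝ} (hI : I ⊆ Ioc 0 (1 / 2)) :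
    Prod.fst '' addressGraph x I = paramSet x ∩ I := by
  ext l
  constructor
  · rintro ⟨⟨l, i⟩, ⟨hl, hi⟩, rfl⟩
    exact ⟨⟨hI hl, i, hi⟩, hl⟩
  · rintro ⟨⟨-, i, hi⟩, hl⟩
    exact ⟨(l, i), ⟨hl, hi⟩, rfl⟩

theorem head_eq_zero_of_mem_addressGraph (hx : x < 1 / 2)
    (hp : p ∈ addressGraph x (Ioc 0 (1 / 2))) : p.2 0 = 0 := by
  obtain ⟨⟨h0, h1⟩, hpx⟩ := hp
  exact head_eq_zero_of_coding_lt h0 (by linarith) (by linarith)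

theorem mul_abs_fst_sub_fst_le_pow (hx : x < 1 / 2) (hb : b < 1 / 2)
    (hp : p ∈ addressGraph x (Ioc 0 b)) (hq : q ∈ addressGraph x (Ioc 0 b))
    (h : p.2 ∈ cylinder q.2 n) : x * (1 - 2 * b) * |p.1 - q.1| ≤ b ^ n := by
  wlog hle : p.1 ≤ q.1 generalizing p q
  · rw [abs_sub_comm]
    exact this hq hp ((PiNat.mem_cylinder_comm _ _ _).1 h) (le_of_not_ge hle)
  obtain ⟨⟨hp0, hpb⟩, hpx⟩ := hp
  obtain ⟨⟨hq0, hqb⟩, hqx⟩ := hq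
  have hhead : p.2 0 = 0 :=
    head_eq_zero_of_mem_addressGraph hx ⟨⟨hp0, hpb.trans hb.le⟩, hpx⟩
  have hx0 : 0 ≤ x := hpx ▸ (coding_mem_Icc hp0 (by linarith) p.2).1
  calc x * (1 - 2 * b) * |p.1 - q.1|
      = x * ((q.1 - p.1) * (1 - 2 * b)) := by
        rw [abs_sub_comm, abs_of_nonneg (sub_nonneg.2 hle), mul_assoc, mul_comm (1 - 2 * b)]
    _ ≤ x * ((q.1 - p.1) * (1 - p.1 - q.1)) := by
        gcongr ?_ * (?_ * ?_)
        linarith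
    _ ≤ coding q.1 p.2 - x := by
        rw [← hpx]
        exact coding_mul_le_coding_sub_coding hp0 hle (by linarith) hhead
    _ = coding q.1 p.2 - coding q.1 q.2 := by rw [hqx]
    _ ≤ q.1 ^ n := (abs_le.1 (abs_coding_sub_coding_le_pow hq0 (by linarith) h)).2
    _ ≤ b ^ n := by gcongr

theorem dimH_paramSet_inter_Ioc_le (hx : x ∈ Ioo 0 (1 / 2)) (hb0 : 0 < b) (hb1 : b < 1) :
    dimH (paramSet x ∩ Ioc 0 b) ≤ similarityDim b := by
  obtain hb | hb := lt_or_ge b (1 / 2)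
  · have hc : 0 < x * (1 - 2 * b) := mul_pos hx.1 (by linarith)
    rw [← image_fst_addressGraph (Ioc_subset_Ioc_right hb.le)]
    exact dimH_image_le_of_dist_le_pow (σ := Prod.snd) (inv_nonneg.2 hc.le) hb0.le hb1
      (two_mul_rpow_similarityDim hb0 hb1).le fun p hp q hq n hpq =>
        (le_inv_mul_iff₀ hc).2 (mul_abs_fst_sub_fst_le_pow hx.2 hb hp hq hpq)
  · have hone : 1 ≤ similarityDim b := similarityDim_half.symm.trans_le <|
      strictMonoOn_similarityDim.monotoneOn (by norm_num) ⟨hb0, hb1⟩ hb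
    exact (dimH_le_one _).trans (by exact_mod_cast hone)

theorem mul_pow_firstDiff_le_abs_fst_sub_fst (ha : 0 < a) (hb : b < 1 / 2)
    (hp : p ∈ addressGraph x (Icc a b)) (hq : q ∈ addressGraph x (Icc a b)) (h : p.2 ≠ q.2) :
    (1 - b) * (1 - 2 * b) * a ^ firstDiff p.2 q.2 ≤ |p.1 - q.1| := by
  obtain ⟨⟨hap, hpb⟩, hpx⟩ := hp
  obtain ⟨⟨haq, hqb⟩, hqx⟩ := hq
  have hp0 : 0 < p.1 := ha.trans_le hap
  have hb' : 0 ≤ 1 - 2 * b := by linarith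
  calc (1 - b) * (1 - 2 * b) * a ^ firstDiff p.2 q.2
      ≤ (1 - p.1) * ((1 - 2 * q.1) * q.1 ^ firstDiff p.2 q.2) := by
        rw [mul_assoc]
        gcongr <;> linarith
    _ ≤ (1 - p.1) * |coding q.1 p.2 - coding q.1 q.2| := by
        gcongr
        · linarith
        · exact mul_pow_firstDiff_le_abs_coding_sub_coding (ha.trans_le haq) (by linarith) h
    _ = (1 - p.1) * |coding p.1 p.2 - coding q.1 p.2| := by rw [hqx, ← hpx, abs_sub_comm]
    _ ≤ |p.1 - q.1| :=
        mul_abs_coding_sub_coding_le (ha.trans_le haq) (by linarith) hp0 (by linarith) p.2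

theorem exists_cylinder_subset_image_snd_addressGraph (ha : 0 < a) (hab : a ≤ b) (hb : b < 1)
    (hia : coding a i < x) (hib : x < coding b i) :
    ∃ n, cylinder i n ⊆ Prod.snd '' addressGraph x (Icc a b) := by
  have hopen : IsOpen {j | coding a j < x ∧ x < coding b j} :=
    (isOpen_lt (continuous_coding ha (hab.trans_lt hb)) continuous_const).inter
      (isOpen_lt continuous_const (continuous_coding (ha.trans_le hab) hb))
  obtain ⟨_, ⟨k, n, rfl⟩, hik, hsub⟩ :=
    (PiNat.isTopologicalBasis_cylinders _).isOpen_iff.1 hopen i ⟨hia, hib⟩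
  rw [← PiNat.mem_cylinder_iff_eq.1 hik] at hsub
  refine ⟨n, fun j hj => ?_⟩
  have hcont : ContinuousOn (coding · j) (Icc a b) := fun l hl =>
    (continuousAt_coding_left (ha.trans_le hl.1) (hl.2.trans_lt hb) j).continuousWithinAt
  obtain ⟨l, hl, hlx⟩ := intermediate_value_Icc hab hcont ⟨(hsub hj).1.le, (hsub hj).2.le⟩
  exact ⟨(l, j), ⟨hl, hlx⟩, rfl⟩

theorem similarityDim_le_dimH_paramSet_inter_Icc (ha : 0 < a) (hab : a ≤ b) (hb : b < 1 / 2)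
    (hia : coding a i < x) (hib : x < coding b i) :
    similarityDim a ≤ dimH (paramSet x ∩ Icc a b) := by
  have ha1 : a < 1 := by linarith
  obtain ⟨n, hn⟩ :=
    exists_cylinder_subset_image_snd_addressGraph ha hab (by linarith) hia hib
  calc (similarityDim a : ℝ≥0∞) = similarityDim a * dimH (ofDigits '' cylinder i n) := by
        rw [dimH_ofDigits_image_cylinder one_lt_two, mul_one]
    _ ≤ similarityDim a * dimH (ofDigits '' (Prod.snd '' addressGraph x (Icc a b))) := by
        gcongr
    _ ≤ dimH (Prod.fst '' addressGraph x (Icc a b)) :=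
        mul_dimH_ofDigits_image_le (mul_pos (by linarith) (by linarith)) ha.le
          (two_mul_rpow_similarityDim ha ha1).ge fun p hp q hq =>
            mul_pow_firstDiff_le_abs_fst_sub_fst ha hb hp hq
    _ = dimH (paramSet x ∩ Icc a b) := by
        rw [image_fst_addressGraph fun l hl => ⟨ha.trans_le hl.1, hl.2.trans hb.le⟩]

theorem coding_lt_of_coding_half_lt (ha0 : 0 < a) (ha : a ≤ 1 / 2)
    (hi : i 0 = 0) (h : coding (1 / 2) i < x * (1 + (1 / 2 - a) ^ 2)) : coding a i < x := by
  have hgain := coding_mul_le_coding_sub_coding ha0 ha (by linarith) hi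
  refine lt_of_mul_lt_mul_right (?_ : coding a i * (1 + (1 / 2 - a) ^ 2) < _)
    (by positivity : 0 ≤ 1 + (1 / 2 - a) ^ 2)
  linarith

theorem exists_coding_lt_lt_coding_half (hx : x ∈ Ioo 0 (1 / 2)) (ha0 : 0 < a) (ha : a < 1 / 2) :
    ∃ i, coding a i < x ∧ x < coding (1 / 2) i := by
  have hgap : 0 < (1 / 2 - a) ^ 2 := pow_pos (sub_pos.2 ha) 2
  obtain ⟨y, hxy, hy⟩ := exists_between (lt_min hx.2
    (lt_mul_of_one_lt_right hx.1 (by linarith : 1 < 1 + (1 / 2 - a) ^ 2)))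
  obtain ⟨hy2, hya⟩ := lt_min_iff.1 hy
  obtain ⟨i, rfl⟩ : y ∈ selfSimilarSet (1 / 2) := by
    rw [selfSimilarSet_half]
    exact ⟨(hx.1.trans hxy).le, by linarith⟩
  have hhead : i 0 = 0 :=
    head_eq_zero_of_coding_lt (l := 1 / 2) (by norm_num) (by norm_num) (by linarith)
  exact ⟨i, coding_lt_of_coding_half_lt ha0 ha.le hhead hya, hxy⟩

theorem exists_coding_lt_lt_coding {l d : ℝ} (hx : x ∈ Ioo 0 (1 / 2)) (hl : l ∈ paramSet x)
    (ha : 0 < a) (hal : a < l) (hld : l < d) :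
    ∃ b ∈ Ico a d, b < 1 / 2 ∧ ∃ i, coding a i < x ∧ x < coding b i := by
  obtain ⟨⟨hl0, hl2⟩, i, hi⟩ := hl
  obtain rfl | hlt := hl2.eq_or_lt
  · obtain ⟨j, hja, hj⟩ := exists_coding_lt_lt_coding_half hx ha hal
    have hnear : ∀ᶠ b in 𝓝[<] (1 / 2), x < coding b j :=
      ((continuousAt_coding_left (by norm_num) (by norm_num) j).eventually_const_lt hj).filter_mono
        nhdsWithin_le_nhds
    obtain ⟨b, hxb, hab, hb⟩ := (hnear.and (Ioo_mem_nhdsLT hal)).exists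
    exact ⟨b, ⟨hab.le, hb.trans hld⟩, hb, j, hja, hxb⟩
  · obtain ⟨b, hlb, hb⟩ := exists_between (lt_min hld hlt)
    obtain ⟨hbd, hb2⟩ := lt_min_iff.1 hb
    have hhead : i 0 = 0 :=
      head_eq_zero_of_mem_addressGraph (p := (l, i)) hx.2 ⟨⟨hl0, hl2⟩, hi⟩
    have hgain : 0 < x * ((b - l) * (1 - l - b)) :=
      mul_pos hx.1 (mul_pos (by linarith) (by linarith))
    have hlb' := coding_mul_le_coding_sub_coding hl0 hlb.le (by linarith) hhead
    have hla : coding a i < coding l i :=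
      coding_lt_coding ha hal (by linarith) hhead (hi ▸ hx.1)
    rw [hi] at hlb' hla
    exact ⟨b, ⟨(hal.trans hlb).le, hbd⟩, hb2, i, hla, by linarith⟩

theorem tendsto_dimH_paramSet_inter_Ioo {l : ℝ} (hx : x ∈ Ioo 0 (1 / 2)) (hl : l ∈ paramSet x) :
    Tendsto (fun δ => dimH (paramSet x ∩ Ioo (l - δ) (l + δ))) (𝓝[>] 0)
      (𝓝 (similarityDim l)) := by
  obtain ⟨hl0, hl2⟩ := hl.1
  have hlim {u : ℝ → ℝ} (hu : Continuous u) (hul : u 0 = l) :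
      Tendsto (fun δ => (similarityDim (u δ) : ℝ≥0∞)) (𝓝[>] 0) (𝓝 (similarityDim l)) :=
    (ENNReal.tendsto_coe.2 <| (continuousAt_similarityDim hl0 (by linarith)).tendsto.comp <|
      hu.tendsto' 0 l hul).mono_left nhdsWithin_le_nhds
  refine tendsto_of_tendsto_of_tendsto_of_le_of_le'
    (hlim (u := fun δ => l - δ / 2) (by fun_prop) (by simp))
    (hlim (u := fun δ => l + δ) (by fun_prop) (by simp)) ?_ ?_
  · filter_upwards [Ioo_mem_nhdsGT hl0] with δ hδ
    obtain ⟨hδ0, hδl⟩ := hδ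
    obtain ⟨b, ⟨hab, hbd⟩, hb, i, hia, hib⟩ :=
      exists_coding_lt_lt_coding hx hl (by linarith : 0 < l - δ / 2) (by linarith)
        (by linarith : l < l + δ)
    refine (similarityDim_le_dimH_paramSet_inter_Icc (by linarith) hab hb hia hib).trans
      (dimH_mono (inter_subset_inter_right _ ?_))
    exact Icc_subset_Ioo (by linarith) hbd
  · filter_upwards [Ioo_mem_nhdsGT (by linarith : 0 < 1 - l)] with δ hδ
    refine (dimH_mono fun y hy => ?_).trans
      (dimH_paramSet_inter_Ioc_le hx (by linarith [hδ.1]) (by linarith [hδ.2]))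
    exact ⟨hy.1, hy.1.1.1, hy.2.2.le⟩

theorem half_mem_paramSet (hx : x ∈ Ioo 0 (1 / 2)) : 1 / 2 ∈ paramSet x := by
  refine ⟨by norm_num, ?_⟩
  rw [selfSimilarSet_half]
  exact ⟨hx.1.le, by linarith [hx.2]⟩

theorem dimH_paramSet (hx : x ∈ Ioo 0 (1 / 2)) : dimH (paramSet x) = 1 := by
  refine le_antisymm (dimH_le_one _) ?_
  have hlim := tendsto_dimH_paramSet_inter_Ioo hx (half_mem_paramSet hx)
  rw [similarityDim_half, ENNReal.coe_one] at hlim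
  exact le_of_tendsto' hlim fun δ => dimH_mono inter_subset_left

theorem volume_paramSet_inter_Ioc (hx : x ∈ Ioo 0 (1 / 2)) (hb0 : 0 < b) (hb : b < 1 / 2) :
    volume (paramSet x ∩ Ioc 0 b) = 0 := by
  have hdim : dimH (paramSet x ∩ Ioc 0 b) < (1 : ℝ≥0) := by
    refine (dimH_paramSet_inter_Ioc_le hx hb0 (by linarith)).trans_lt (ENNReal.coe_lt_coe.2 ?_)
    rw [← similarityDim_half]
    exact strictMonoOn_similarityDim ⟨hb0, by linarith⟩ (by norm_num) hb
  have hnull := hausdorffMeasure_of_dimH_lt hdim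
  rwa [NNReal.coe_one, hausdorffMeasure_real] at hnull

theorem volume_paramSet (hx : x ∈ Ioo 0 (1 / 2)) : volume (paramSet x) = 0 := by
  rw [← measure_sdiff_null (Real.volume_singleton (a := 1 / 2))]
  refine measure_null_of_locally_null _ fun l hl => ?_
  obtain ⟨⟨⟨hl0, hl2⟩, -⟩, hne⟩ := hl
  obtain ⟨b, hlb, hb⟩ := exists_between (lt_of_le_of_ne hl2 hne)
  refine ⟨paramSet x ∩ Ioc 0 b, mem_nhdsWithin.2 ⟨Iio b, isOpen_Iio, hlb, ?_⟩,
    volume_paramSet_inter_Ioc hx (hl0.trans hlb) hb⟩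
  exact fun m hm => ⟨hm.2.1, hm.2.1.1.1, le_of_lt hm.1⟩

end ParamSet

end CantorParam

theorem theorem1p2 (x : ℝ) (hx : x ∈ Set.Ioo (0 : ℝ) (1 / 2)) :
    MeasureTheory.volume (CantorParam.paramSet x) = 0 ∧
    dimH (CantorParam.paramSet x) = 1 ∧
    ∀ l ∈ CantorParam.paramSet x,
      Filter.Tendsto
        (fun δ : ℝ => dimH (CantorParam.paramSet x ∩ Set.Ioo (l - δ) (l + δ)))
        (nhdsWithin 0 (Set.Ioi 0))
        (nhds (ENNReal.ofReal (Real.log 2 / (-Real.log l)))) ∧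
      dimH (CantorParam.selfSimilarSet l) = ENNReal.ofReal (Real.log 2 / (-Real.log l)) :=
  ⟨CantorParam.volume_paramSet hx, CantorParam.dimH_paramSet hx, fun _ hl =>
    ⟨CantorParam.tendsto_dimH_paramSet_inter_Ioo hx hl,
      CantorParam.dimH_selfSimilarSet hl.1.1 hl.1.2⟩⟩
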